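/- Let a finite connected graph be cellularly embedded in a closed oriented surface, and let $S$ be the surface obtained by removing the interiors of some (possibly no) faces; "plaquette" means a face that has not been removed. Put a qubit on every edge. For a set of edges $z$ (counted modulo 2) let $\sigma^z(z)=\prod_{i\in z}\sigma^z_i$ and $\sigma^x(z)=\prod_{i\in z}\sigma^x_i$; for a plaquette $p$ let $B_p=\sigma^z(\partial p)$, where an edge that borders $p$ on both sides is counted twice. Let $W^z_1,\dots,W^z_\kappa$ be the operators $\sigma^z(z_i)$ of a complete set of independent non-contractible loops on the graph (the $z_i$ represent a basis of the $\mathbb F_2$-cycles of the graph modulo boundaries of plaquettes), and let $W^x_1,\dots,W^x_\kappa$ be the operators $\sigma^x(x_i)$ of a complete set of independent non-contractible loops on the dual graph (the $x_i$ represent a basis of the edge sets that meet every plaquette boundary an even number of times, modulo stars of vertices). Define the toric code ground state $$|\psi_0\rangle=N\prod_{\text{indep. }B_p}\frac{1+B_p}{2}\;\prod_{i=1}^{\kappa}\frac{1+W^z_i}{2}\;|{+}\cdots{+}\rangle,\qquad \langle\psi_0|\psi_0\rangle=1,$$ where the first product runs over a maximal independent set of plaquettes, and, for complex $c=(c_{k})_{k\in\{0,1\}^\kappa}$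 with $\sum_k|c_k|^2=1$, the generic ground state $$|\psi\rangle=\sum_{k\in\{0,1\}^\kappa}c_{k}\,(W^x_1)^{k_1}\cdots(W^x_\kappa)^{k_\kappa}|\psi_0\rangle .$$ Let $A$ be a set of edges and $B$ its complement. Thicken each edge to the closed quadrilateral spanned by its two end points and the centres of the two adjacent faces; these quadrilaterals tile the closed surface. Suppose that $A$ is a contractible, simply connected region away from the boundary of $S$: no edge of $A$ borders a removed face, and the union of the quadrilaterals of the edges in $A$ is a closed disc (a non-empty, connected, simply connected surface with non-empty boundary). Let $n_{AB}$ be the number of plaquettes across the boundary $A|B$, i.e. those bordered by an edge of $A$ and by an edge of $B$. Then $n_{AB}\ge 1$ and, with $\mu_{\max}=2^{\,n_{AB}-1}$, there are orthonormal states $|e_1\rangle,\dots,|e_{\mu_{\max}}\rangle$ of $A$ such that: 1. there are orthonormal states $|f_\mu\rangle$ of $B$ with $$|\psi_0\rangle=\mu_{\max}^{-1/2}\sum_{\mu=1}^{\mu_{\max}}|e_\mu\rangle_A\otimes|f_\mu\rangle_B ;$$ 2. for every generic ground state $|\psi\rangle$ as above there are orthonormal states $|f^{(\psi)}_\mu\rangle$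 of $B$ with $$|\psi\rangle=\mu_{\max}^{-1/2}\sum_{\mu=1}^{\mu_{\max}}|e_\mu\rangle_A\otimes|f^{(\psi)}_\mu\rangle_B ,$$ with the same states $|e_\mu\rangle$ as in 1. -/

import Mathlib

/-- A finite connected graph cellularly embedded in a closed oriented surface, given by its rotation
system.  `D` is the set of darts (edges with a direction), `rot d` is the next dart
counterclockwise among the darts leaving the same vertex, `rev d` is the reversed dart. -/
structure SurfaceGraph (D : Type*) where
  rot : Equiv.Perm D
  rev : Equiv.Perm D
  rev_rev : ∀ d, rev (rev d) = d
  rev_ne : ∀ d, rev d ≠ d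
  connected : ∀ d d' : D, Relation.ReflTransGen (fun x y => y = rot x ∨ y = rev x) d d'

namespace SurfaceGraph

variable {D : Type*} (M : SurfaceGraph D)

/-- The dart that follows `d` on the boundary of the face at its side: run along `d`, then turn. -/
def next : Equiv.Perm D := M.rev.trans M.rot

/-- Vertices: orbits of the rotation. -/
def Vertex : Type _ := Quotient (Equiv.Perm.SameCycle.setoid M.rot)

/-- Edges: orbits of the reversal. -/
def Edge : Type _ := Quotient (Equiv.Perm.SameCycle.setoid M.rev)

/-- Faces: orbits of the face permutation. -/
def Face : Type _ := Quotient (Equiv.Perm.SameCycle.setoid M.next)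

/-- The vertex at which a dart starts. -/
def vertex (d : D) : M.Vertex := Quotient.mk _ d

/-- The edge underlying a dart. -/
def edge (d : D) : M.Edge := Quotient.mk _ d

/-- The face on whose boundary a dart runs. -/
def face (d : D) : M.Face := Quotient.mk _ d

instance [Finite D] : Finite M.Edge := inferInstanceAs (Finite (Quotient _))

noncomputable instance [Finite D] : Fintype M.Edge := Fintype.ofFinite _

noncomputable instance : DecidableEq M.Edge := Classical.decEq _

noncomputable instance [Finite D] (A : Set M.Edge) : Fintype A := Fintype.ofFinite _

/-! ### Regions -/

/-- A walk inside the region `A`: a list of darts of `A`, each starting where the previous ends. -/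
def IsWalk (A : Set M.Edge) (l : List D) : Prop :=
  (∀ d ∈ l, M.edge d ∈ A) ∧ l.IsChain (fun d d' => M.vertex d' = M.vertex (M.rev d))

/-- A walk inside `A` that ends where it starts. -/
def IsClosedWalk (A : Set M.Edge) (l : List D) : Prop :=
  M.IsWalk A l ∧ ∀ d ∈ l.getLast?, ∀ d' ∈ l.head?, M.vertex d' = M.vertex (M.rev d)

/-- The closed walk once around the face of `d`, starting with `d`. -/
noncomputable def faceWalk (d : D) : List D :=
  List.iterate M.next d (Function.minimalPeriod M.next d)

/-- Homotopy of walks inside `A`: generated by inserting or deleting a backtracking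
`d, rev d`, and a tour around a face all of whose edges lie in `A`. -/
inductive Homotopic (A : Set M.Edge) : List D → List D → Prop
  | refl (l : List D) : Homotopic A l l
  | symm {l l' : List D} : Homotopic A l l' → Homotopic A l' l
  | trans {l l' l'' : List D} : Homotopic A l l' → Homotopic A l' l'' → Homotopic A l l''
  | backtrack (l₁ l₂ : List D) (d : D) :
      M.IsWalk A (l₁ ++ [d, M.rev d] ++ l₂) →
      Homotopic A (l₁ ++ [d, M.rev d] ++ l₂) (l₁ ++ l₂)
  | face (l₁ l₂ : List D) (d : D) :
      M.IsWalk A (l₁ ++ M.faceWalk d ++ l₂) →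
      Homotopic A (l₁ ++ M.faceWalk d ++ l₂) (l₁ ++ l₂)

/-- The region `A` is a contractible, simply connected region (a closed disc) that stays away from
the boundary of the surface.  Here `R` is the set of faces removed from the closed surface; the
surface under consideration is the complement of these open faces.  Each edge is thickened to the
quadrilateral spanned by its two end points and the centres of the two adjacent faces; these
quadrilaterals tile the surface and the region is the union of those of the edges in `A`.
The two `sector` conditions say that this union is a surface with boundary (around each vertex and
each face centre, the region occupies at most one sector, so that it is not pinched there). -/
structure IsDisc (R : Set M.Face) (A : Set M.Edge) : Prop where
  nonempty : A.Nonempty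
  ne_univ : A ≠ Set.univ
  interior : ∀ d, M.edge d ∈ A → M.face d ∉ R
  vertex_sector : ∀ d d', M.vertex d = M.vertex d' →
    M.edge d ∈ A → M.edge (M.rot d) ∉ A → M.edge d' ∈ A → M.edge (M.rot d') ∉ A → d = d'
  face_sector : ∀ d d', M.face d = M.face d' →
    M.edge d ∈ A → M.edge (M.next d) ∉ A → M.edge d' ∈ A → M.edge (M.next d') ∉ A → d = d'
  pathConnected : ∀ d d', M.edge d ∈ A → M.edge d' ∈ A →
    ∃ l, M.IsWalk A l ∧ l.head? = some d ∧ l.getLast? = some d'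
  simplyConnected : ∀ l, M.IsClosedWalk A l → M.Homotopic A l []

/-- The number `n_AB` of plaquettes across the boundary of `A`: the faces (other than the removed
ones) which have an edge in `A` and an edge outside `A`. -/
noncomputable def crossing (R : Set M.Face) (A : Set M.Edge) : ℕ :=
  Set.ncard {p : M.Face | p ∉ R ∧ (∃ d, M.face d = p ∧ M.edge d ∈ A) ∧
    ∃ d, M.face d = p ∧ M.edge d ∉ A}

/-! ### Cycles and cocycles modulo 2 -/

/-- Sets of edges as vectors over `𝔽₂`. -/
abbrev Chain : Type _ := M.Edge → ZMod 2

variable [Fintype D]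

open scoped Classical in
/-- The edges ending at the vertex `s` (modulo 2: a loop at `s` ends there twice). -/
noncomputable def star (s : M.Vertex) : M.Chain :=
  ∑ d : D with M.vertex d = s, Pi.single (M.edge d) 1

open scoped Classical in
/-- The edges surrounding the face `p` (modulo 2: an edge may have `p` on both sides). -/
noncomputable def plaquette (p : M.Face) : M.Chain :=
  ∑ d : D with M.face d = p, Pi.single (M.edge d) 1

/-- The cycles of the graph: every star is met an even number of times. -/
noncomputable def cycles : Submodule (ZMod 2) M.Chain where
  carrier := {z | ∀ s, z ⬝ᵥ M.star s = 0}
  add_mem' ha hb s := by rw [add_dotProduct, ha s, hb s, add_zero]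
  zero_mem' s := zero_dotProduct _
  smul_mem' c z hz s := by rw [smul_dotProduct, hz s, smul_zero]

/-- The contractible cycles: sums of boundaries of faces of the surface. -/
noncomputable def boundaries (R : Set M.Face) : Submodule (ZMod 2) M.Chain :=
  Submodule.span (ZMod 2) (M.plaquette '' Rᶜ)

/-- The cycles of the dual graph: every face of the surface is met an even number of times. -/
noncomputable def dualCycles (R : Set M.Face) : Submodule (ZMod 2) M.Chain where
  carrier := {x | ∀ p ∉ R, x ⬝ᵥ M.plaquette p = 0}
  add_mem' ha hb p hp := by rw [add_dotProduct, ha p hp, hb p hp, add_zero]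
  zero_mem' p _ := zero_dotProduct _
  smul_mem' c x hx p hp := by rw [smul_dotProduct, hx p hp, smul_zero]

/-- The contractible dual cycles: sums of stars. -/
noncomputable def dualBoundaries : Submodule (ZMod 2) M.Chain :=
  Submodule.span (ZMod 2) (Set.range M.star)

/-- `p` lists a maximal independent set of plaquettes. -/
def IsIndepPlaquettes (R : Set M.Face) {m : ℕ} (p : Fin m → M.Face) : Prop :=
  (∀ i, p i ∉ R) ∧ LinearIndependent (ZMod 2) (fun i => M.plaquette (p i)) ∧
    Submodule.span (ZMod 2) (Set.range fun i => M.plaquette (p i)) = M.boundaries R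

/-- `z` is a complete set of independent non-contractible loops on the graph. -/
def IsLoopBasis (R : Set M.Face) {κ : ℕ} (z : Fin κ → M.Chain) : Prop :=
  LinearIndependent (ZMod 2) (fun i => Submodule.Quotient.mk (p := M.boundaries R) (z i)) ∧
    M.boundaries R ⊔ Submodule.span (ZMod 2) (Set.range z) = M.cycles

/-- `x` is a complete set of independent non-contractible loops on the dual graph. -/
def IsDualLoopBasis (R : Set M.Face) {κ : ℕ} (x : Fin κ → M.Chain) : Prop :=
  LinearIndependent (ZMod 2) (fun i => Submodule.Quotient.mk (p := M.dualBoundaries) (x i)) ∧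
    M.dualBoundaries ⊔ Submodule.span (ZMod 2) (Set.range x) = M.dualCycles R

end SurfaceGraph

/-! ### Qubits -/

/-- The Hilbert space `(ℂ²)^{⊗ ι}`, in coordinates with respect to the computational basis. -/
abbrev Qubits (ι : Type*) : Type _ := EuclideanSpace ℂ (ι → ZMod 2)

namespace Qubits

/-- The product state `|+⋯+⟩`, where `|+⟩ = (|0⟩ + |1⟩) / √2`. -/
noncomputable def plus (ι : Type*) [Fintype ι] : Qubits ι :=
  WithLp.toLp 2 fun _ => ∏ _i : ι, ((Real.sqrt 2 : ℝ) : ℂ)⁻¹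

/-- The state `|u⟩_A ⊗ |v⟩_B`, where `B` is the complement of `A`. -/
noncomputable def tensor {ι : Type*} {A : Set ι} (u : Qubits A) (v : Qubits ↥(Aᶜ)) : Qubits ι :=
  WithLp.toLp 2 fun s => u (fun i => s i) * v (fun i => s i)

variable {ι : Type*}

/-- Pauli `σ^z` on the qubit `i`. -/
noncomputable def pauliZ (i : ι) : Module.End ℂ (Qubits ι) where
  toFun v := WithLp.toLp 2 fun s => (if s i = 0 then 1 else -1) * v s
  map_add' v w := by ext s; simp [mul_add]
  map_smul' c v := by ext s; simp [mul_left_comm]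

theorem commute_pauliZ (i j : ι) : Commute (pauliZ i) (pauliZ j) := by
  ext v s
  by_cases hi : s i = 0 <;> by_cases hj : s j = 0 <;> simp [pauliZ, hi, hj]

variable [DecidableEq ι]

/-- Pauli `σ^x` on the qubit `i`. -/
noncomputable def pauliX (i : ι) : Module.End ℂ (Qubits ι) where
  toFun v := WithLp.toLp 2 fun s => v (s + Pi.single i 1)
  map_add' v w := by ext s; simp
  map_smul' c v := by ext s; simp

theorem commute_pauliX (i j : ι) : Commute (pauliX i) (pauliX j) := by
  ext v s
  simp [pauliX, add_right_comm]

variable [Fintype ι]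

/-- The product of the `σ^z` over the qubits in the support of `z`. -/
noncomputable def stringZ (z : ι → ZMod 2) : Module.End ℂ (Qubits ι) :=
  (Finset.univ.filter fun i => z i ≠ 0).noncommProd pauliZ fun i _ j _ _ => commute_pauliZ i j

/-- The product of the `σ^x` over the qubits in the support of `x`. -/
noncomputable def stringX (x : ι → ZMod 2) : Module.End ℂ (Qubits ι) :=
  (Finset.univ.filter fun i => x i ≠ 0).noncommProd pauliX fun i _ j _ _ => commute_pauliX i j

end Qubits

namespace SurfaceGraph

variable {D : Type*} [Fintype D] (M : SurfaceGraph D)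

open Qubits

/-- The ground state `|ψ₀⟩` with normalization constant `N`:
`N ∏ (1 + B_p)/2 ∏ (1 + W_i^z)/2 |+⋯+⟩`, the first product over the listed plaquettes. -/
noncomputable def groundState {m κ : ℕ} (p : Fin m → M.Face) (z : Fin κ → M.Chain) (N : ℂ) :
    Qubits M.Edge :=
  N • ((List.ofFn fun i => (1 / 2 : ℂ) • (1 + stringZ (M.plaquette (p i)))).prod *
    (List.ofFn fun i => (1 / 2 : ℂ) • (1 + stringZ (z i))).prod) (plus M.Edge)

/-- The superposition `∑_k c_k (W_1^x)^{k_1} ⋯ (W_κ^x)^{k_κ} |ψ₀⟩`. -/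
noncomputable def genericState {κ : ℕ} (x : Fin κ → M.Chain) (ψ₀ : Qubits M.Edge)
    (c : (Fin κ → Fin 2) → ℂ) : Qubits M.Edge :=
  ∑ k : Fin κ → Fin 2,
    c k • (List.ofFn fun i => stringX (x i) ^ (k i : ℕ)).prod ψ₀

end SurfaceGraph

/-! ### Flat Schmidt decompositions from translation invariance -/

namespace Qubits

/-! Let S be the span of the stars and X the space of dual cycles. In the computational basis ψ₀ is
constant on S and zero elsewhere: its projectors keep exactly the vectors orthogonal to all cycles,
and these form S by double complement. A generic state lives on X and is still invariant under
translation by S.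

Let V be the restriction of S to A, and K the space of elements of S supported in A. If X restricts
into V and every element of X supported in A is already in S, `exists_schmidt` gives a flat
decomposition with |V|/|K| terms. The states on A are the normalised indicators of the cosets of K
in V, hence independent of ψ; those on B are slices of ψ, with disjoint supports.

The disc provides both conditions. By simple connectedness a vector orthogonal to the inner faces
has a vertex potential (`IsDisc.exists_potential`), so V is the complement of the inner face
boundaries. The rest is the dimension count `IsDisc.finrank_facts`. It uses that the region and its
dual are connected, and that mixed vertices and mixed faces are both counted by the corners where
the rotation leaves A, so that there are n_AB of each. The result is dim V - dim K = n_AB - 1. -/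

theorem orthonormal_of_disjoint_support {T κ : Type*} [Fintype T] (v : κ → EuclideanSpace ℂ T)
    (hnorm : ∀ k, ‖v k‖ = 1) (hdisj : ∀ k l t, v k t ≠ 0 → v l t ≠ 0 → k = l) :
    Orthonormal ℂ v := by
  refine ⟨hnorm, fun k l hkl => ?_⟩
  change inner ℂ (v k) (v l) = 0
  rw [PiLp.inner_apply]
  refine Finset.sum_eq_zero fun t _ => ?_
  by_cases hk : v k t = 0
  · simp [hk]
  · by_cases hl : v l t = 0
    · simp [hl]
    · exact absurd (hdisj k l t hk hl) hkl

/-- The Schmidt index runs through the quotient V/K; choosing representatives turns it into `Fin q`.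
-/
theorem exists_coset_representatives {E : Type*} [AddCommGroup E] [Module (ZMod 2) E] [Finite E]
    (K V : Submodule (ZMod 2) E) (hKV : K ≤ V) (q : ℕ) (hq : q * Nat.card K = Nat.card V) :
    ∃ r : Fin q → E, (∀ μ, r μ ∈ V) ∧ (∀ μ ν, r μ - r ν ∈ K → μ = ν) ∧
      ∀ a ∈ V, ∃ μ, a - r μ ∈ K := by
  let K' := K.comap V.subtype
  have : Finite (V ⧸ K') := Quotient.finite _
  have hcard : Nat.card (V ⧸ K') = q := by
    have h := Submodule.card_eq_card_quotient_mul_card K'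
    have h' : Nat.card K' = Nat.card K :=
      Nat.card_congr (Submodule.comapSubtypeEquivOfLe hKV).toEquiv
    rw [h', ← hq] at h
    have : 0 < Nat.card K := Nat.card_pos
    nlinarith
  let φ : Fin q ≃ V ⧸ K' := (Finite.equivFinOfCardEq hcard).symm
  choose r hr using fun μ => Submodule.Quotient.mk_surjective K' (φ μ)
  refine ⟨fun μ => r μ, fun μ => (r μ).2, fun μ ν h => φ.injective ?_, fun a ha => ?_⟩
  · rw [← hr, ← hr, Submodule.Quotient.eq]
    exact h
  · refine ⟨φ.symm (Submodule.Quotient.mk ⟨a, ha⟩), ?_⟩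
    have : (Submodule.Quotient.mk ⟨a, ha⟩ : V ⧸ K') =
        Submodule.Quotient.mk (r (φ.symm (Submodule.Quotient.mk ⟨a, ha⟩))) := by
      rw [hr, Equiv.apply_symm_apply]
    rw [Submodule.Quotient.eq] at this
    exact this

variable {ι : Type*}

/-- Restriction of a vector to the coordinates in `A`. -/
def restrict (A : Set ι) : (ι → ZMod 2) →ₗ[ZMod 2] (A → ZMod 2) :=
  LinearMap.funLeft (ZMod 2) (ZMod 2) Subtype.val

open scoped Classical in
/-- The vector with the given coordinates in `A` and in its complement. -/
noncomputable def glue (A : Set ι) : (ι → ZMod 2) ≃ (A → ZMod 2) × (↥(Aᶜ) → ZMod 2) :=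
  Equiv.piEquivPiSubtypeProd (· ∈ A) fun _ => ZMod 2

open scoped Classical in
/-- Extension by zero of a vector on `A`. -/
noncomputable def extend (A : Set ι) : (A → ZMod 2) →ₗ[ZMod 2] (ι → ZMod 2) where
  toFun a i := if h : i ∈ A then a ⟨i, h⟩ else 0
  map_add' a b := by ext i; by_cases h : i ∈ A <;> simp [h]
  map_smul' c a := by ext i; by_cases h : i ∈ A <;> simp [h]

theorem restrict_apply (A : Set ι) (s : ι → ZMod 2) (i : A) : restrict A s i = s i := rfl

theorem extend_apply_mem {A : Set ι} (a : A → ZMod 2) {i : ι} (h : i ∈ A) :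
    extend A a i = a ⟨i, h⟩ := by simp [extend, h]

theorem extend_apply_notMem {A : Set ι} (a : A → ZMod 2) {i : ι} (h : i ∉ A) :
    extend A a i = 0 := by simp [extend, h]

theorem restrict_extend (A : Set ι) (a : A → ZMod 2) : restrict A (extend A a) = a := by
  ext i; rw [restrict_apply, extend_apply_mem a i.2]

theorem glue_symm_apply_mem {A : Set ι} (a : A → ZMod 2) (b : ↥(Aᶜ) → ZMod 2) {i : ι}
    (h : i ∈ A) : (glue A).symm (a, b) i = a ⟨i, h⟩ := by
  simp [glue, Equiv.piEquivPiSubtypeProd, h]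

theorem glue_symm_apply_notMem {A : Set ι} (a : A → ZMod 2) (b : ↥(Aᶜ) → ZMod 2) {i : ι}
    (h : i ∉ A) : (glue A).symm (a, b) i = b ⟨i, h⟩ := by
  simp [glue, Equiv.piEquivPiSubtypeProd, h]

theorem glue_symm_add_extend (A : Set ι) (a a' : A → ZMod 2) (b : ↥(Aᶜ) → ZMod 2) :
    (glue A).symm (a, b) + extend A a' = (glue A).symm (a + a', b) := by
  ext i
  by_cases h : i ∈ A
  · simp [glue_symm_apply_mem _ _ h, extend_apply_mem _ h]
  · simp [glue_symm_apply_notMem _ _ h, extend_apply_notMem _ h]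

theorem glue_symm_add (A : Set ι) (a : A → ZMod 2) (b : ↥(Aᶜ) → ZMod 2) (t : ι → ZMod 2) :
    (glue A).symm (a, b) + t = (glue A).symm (a + restrict A t, b + restrict Aᶜ t) := by
  ext i
  by_cases h : i ∈ A
  · simp [glue_symm_apply_mem _ _ h, restrict_apply]
  · simp [glue_symm_apply_notMem _ _ h, restrict_apply]

theorem glue_symm_sub_glue_symm (A : Set ι) (a a' : A → ZMod 2) (b : ↥(Aᶜ) → ZMod 2) :
    (glue A).symm (a, b) - (glue A).symm (a', b) = extend A (a - a') := by
  ext i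
  by_cases h : i ∈ A
  · simp [glue_symm_apply_mem _ _ h, extend_apply_mem _ h]
  · simp [glue_symm_apply_notMem _ _ h, extend_apply_notMem _ h]

theorem restrict_glue_symm (A : Set ι) (a : A → ZMod 2) (b : ↥(Aᶜ) → ZMod 2) :
    restrict A ((glue A).symm (a, b)) = a := by
  ext i; rw [restrict_apply, glue_symm_apply_mem _ _ i.2]

/-- Schmidt decomposition with common states on `A` for all unit vectors that are supported in
`X` and invariant under translation by `S`. -/
theorem exists_schmidt [Fintype ι] [DecidableEq ι] (A : Set ι) [Fintype A] [Fintype ↥(Aᶜ)]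
    (S X : Submodule (ZMod 2) (ι → ZMod 2))
    (hres : ∀ x ∈ X, restrict A x ∈ S.map (restrict A))
    (hext : ∀ a, extend A a ∈ X → extend A a ∈ S) (q : ℕ)
    (hq : q * Nat.card (S.comap (extend A)) = Nat.card (S.map (restrict A))) :
    ∃ e : Fin q → Qubits A, Orthonormal ℂ e ∧ ∀ ψ : Qubits ι, ‖ψ‖ = 1 → (∀ s ∉ X, ψ s = 0) →
      (∀ s, ∀ t ∈ S, ψ (s + t) = ψ s) → ∃ f : Fin q → Qubits ↥(Aᶜ), Orthonormal ℂ f ∧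
        ψ = ((q : ℝ) ^ (-(1 / 2) : ℝ)) • ∑ μ, tensor (e μ) (f μ) := by
  classical
  set K := S.comap (extend A) with hK
  set V := S.map (restrict A) with hV
  have hKV : K ≤ V := fun a ha => ⟨_, ha, restrict_extend A a⟩
  obtain ⟨r, hrV, hrinj, hrsurj⟩ := exists_coset_representatives K V hKV q hq
  have hKpos : (0 : ℝ) < Nat.card K := by exact_mod_cast Nat.card_pos
  have hVpos : (0 : ℝ) < Nat.card V := by exact_mod_cast Nat.card_pos
  have hqR : (q : ℝ) * Nat.card K = Nat.card V := by exact_mod_cast hq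
  have hqpos : (0 : ℝ) < q := by
    rcases (Nat.cast_nonneg q : (0 : ℝ) ≤ q).eq_or_lt with h | h
    · rw [← h] at hqR; linarith
    · exact h
  let α : ℝ := Real.sqrt (Nat.card K)
  have hα : α ^ 2 = Nat.card K := Real.sq_sqrt hKpos.le
  have hα0 : 0 < α := Real.sqrt_pos.2 hKpos
  let β : ℝ := Real.sqrt q
  have hβ : β ^ 2 = q := Real.sq_sqrt hqpos.le
  have hβ0 : 0 < β := Real.sqrt_pos.2 hqpos
  -- Uniform superposition over the coset of `r μ`, normalised by the square root of |K|.
  let e : Fin q → Qubits A := fun μ =>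
    WithLp.toLp 2 fun a => if a - r μ ∈ K then ((α⁻¹ : ℝ) : ℂ) else 0
  have he : ∀ μ a, e μ a = if a - r μ ∈ K then ((α⁻¹ : ℝ) : ℂ) else 0 := fun _ _ => rfl
  have hcancel : ∀ {a : A → ZMod 2} {μ ν}, a - r μ ∈ K → a - r ν ∈ K → μ = ν := by
    intro a μ ν h₁ h₂
    refine hrinj _ _ ?_
    have := K.sub_mem h₂ h₁
    rwa [sub_sub_sub_cancel_left] at this
  refine ⟨e, orthonormal_of_disjoint_support e (fun μ => ?_) fun μ ν a h₁ h₂ => ?_, ?_⟩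
  · rw [← sq_eq_sq₀ (norm_nonneg _) zero_le_one, EuclideanSpace.norm_sq_eq, one_pow]
    have : ∀ a, ‖e μ a‖ ^ 2 = if a - r μ ∈ K then (Nat.card K : ℝ)⁻¹ else 0 := by
      intro a
      rw [he]
      split_ifs
      · rw [Complex.norm_real, Real.norm_eq_abs, sq_abs, inv_pow, hα]
      · simp
    simp only [this]
    rw [← Equiv.sum_comp (Equiv.addRight (r μ))]
    simp only [Equiv.coe_addRight, add_sub_cancel_right]
    rw [← Finset.sum_filter, Finset.sum_const, nsmul_eq_mul]
    have : (Finset.univ.filter fun a => a ∈ K).card = Nat.card K := by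
      rw [Nat.card_eq_fintype_card, ← Fintype.card_subtype]
    rw [this, mul_inv_cancel₀ hKpos.ne']
  · rw [he] at h₁ h₂
    exact hcancel (by_contra fun h => h₁ (if_neg h)) (by_contra fun h => h₂ (if_neg h))
  · intro ψ hψ hψX hψS
    -- The probability of finding `a` on A. It vanishes off V and, by invariance, is constant on V,
    -- so it equals 1/|V| there.
    let g : (A → ZMod 2) → ℝ := fun a => ∑ b, ‖ψ ((glue A).symm (a, b))‖ ^ 2
    have hg : ∑ a, g a = 1 := by
      have h := EuclideanSpace.norm_sq_eq ψ
      rw [hψ, one_pow, ← (glue A).symm.sum_comp, Fintype.sum_prod_type] at h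
      exact h.symm
    have hgS : ∀ a, ∀ t ∈ S, g (a + restrict A t) = g a := by
      intro a t ht
      simp only [g]
      rw [← Equiv.sum_comp (Equiv.addRight (restrict Aᶜ t))]
      refine Finset.sum_congr rfl fun b _ => ?_
      rw [Equiv.coe_addRight, ← glue_symm_add, hψS _ _ ht]
    have hg0 : ∀ t ∈ V, g t = g 0 := by
      rintro _ ⟨t, ht, rfl⟩
      simpa using hgS 0 t ht
    have hzero : ∀ a ∉ V, ∀ b, ψ ((glue A).symm (a, b)) = 0 := by
      intro a ha b
      refine hψX _ fun h => ha ?_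
      simpa [restrict_glue_symm] using hres _ h
    have hsum : (Nat.card V : ℝ) * g 0 = 1 := by
      rw [← hg, ← Finset.sum_filter_add_sum_filter_not Finset.univ (· ∈ V),
        Finset.sum_congr rfl (fun a ha => hg0 a (Finset.mem_filter.1 ha).2),
        Finset.sum_eq_zero (s := Finset.univ.filter (· ∉ V)) fun a ha => ?_, Finset.sum_const,
        nsmul_eq_mul, add_zero, Nat.card_eq_fintype_card, ← Fintype.card_subtype]
      exact Finset.sum_eq_zero fun b _ => by simp [hzero a (Finset.mem_filter.1 ha).2 b]
    -- The slice of ψ at `r μ` has squared norm 1/|V|; the factor `β * α` is the square root of q|K|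
    -- = |V|.
    let f : Fin q → Qubits ↥(Aᶜ) := fun μ =>
      WithLp.toLp 2 fun b => ((β * α : ℝ) : ℂ) * ψ ((glue A).symm (r μ, b))
    have hf : ∀ μ b, f μ b = ((β * α : ℝ) : ℂ) * ψ ((glue A).symm (r μ, b)) := fun _ _ => rfl
    refine ⟨f, orthonormal_of_disjoint_support f (fun μ => ?_) fun μ ν b h₁ h₂ => ?_, ?_⟩
    · rw [← sq_eq_sq₀ (norm_nonneg _) zero_le_one, EuclideanSpace.norm_sq_eq, one_pow]
      simp only [hf, norm_mul, mul_pow, Complex.norm_real, Real.norm_eq_abs, sq_abs]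
      rw [← Finset.mul_sum]
      change β ^ 2 * α ^ 2 * g (r μ) = 1
      rw [hg0 _ (hrV μ), hα, hβ, hqR, hsum]
    · rw [hf] at h₁ h₂
      have hX : ∀ s, ψ s ≠ 0 → s ∈ X := fun s hs => by_contra fun h => hs (hψX s h)
      -- If two slices share `b`, the difference of the two configurations is an element of X
      -- supported in A, hence of S.
      refine hrinj _ _ (hext _ ?_)
      rw [← glue_symm_sub_glue_symm A _ _ b]
      exact X.sub_mem (hX _ (right_ne_zero_of_mul h₁)) (hX _ (right_ne_zero_of_mul h₂))
    · ext s
      obtain ⟨⟨a, b⟩, rfl⟩ := (glue A).symm.surjective s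
      have htensor : ∀ μ, tensor (e μ) (f μ) ((glue A).symm (a, b)) = e μ a * f μ b := by
        intro μ
        have h₁ : (fun i : A => (glue A).symm (a, b) i) = a := restrict_glue_symm A a b
        have h₂ : (fun i : ↥(Aᶜ) => (glue A).symm (a, b) i) = b := by
          ext i; exact glue_symm_apply_notMem a b i.2
        change e μ (fun i : A => (glue A).symm (a, b) i) *
          f μ (fun i : ↥(Aᶜ) => (glue A).symm (a, b) i) = _
        rw [h₁, h₂]
      have hqβ : (q : ℝ) ^ (-(1 / 2) : ℝ) = β⁻¹ := by
        rw [Real.rpow_neg hqpos.le, ← Real.sqrt_eq_rpow]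
      rw [hqβ, PiLp.smul_apply, WithLp.ofLp_sum, Finset.sum_apply]
      simp only [htensor]
      by_cases ha : a ∈ V
      · obtain ⟨μ, hμ⟩ := hrsurj a ha
        rw [Finset.sum_eq_single μ]
        · rw [he, hf, if_pos hμ]
          -- Moving `a` inside its coset of K is a translation by an element of S, so the slice
          -- depends on the coset only.
          have : ψ ((glue A).symm (a, b)) = ψ ((glue A).symm (r μ, b)) := by
            rw [← hψS ((glue A).symm (r μ, b)) _ hμ, glue_symm_add_extend, add_sub_cancel]
          rw [this, Complex.real_smul]
          push_cast
          have h1 : (α : ℂ) ≠ 0 := by exact_mod_cast hα0.ne'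
          have h2 : (β : ℂ) ≠ 0 := by exact_mod_cast hβ0.ne'
          field_simp
        · intro ν _ hν
          rw [he, if_neg (fun h => hν (hcancel h hμ)), zero_mul]
        · simp
      · rw [hzero a ha b, Finset.sum_eq_zero, smul_zero]
        intro μ _
        rw [he, if_neg (fun h => ha ?_), zero_mul]
        simpa using V.add_mem (hKV h) (hrV μ)

end Qubits

/-! ### Orthogonality over 𝔽₂ and the combinatorics of darts -/

namespace SurfaceGraph

open Qubits

/-- The orthogonal complement for the dot product over `𝔽₂`. -/
def perp {T : Type*} [Fintype T] (W : Submodule (ZMod 2) (T → ZMod 2)) :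
    Submodule (ZMod 2) (T → ZMod 2) :=
  LinearMap.BilinForm.orthogonal (dotProductBilin (ZMod 2) (ZMod 2)) W

theorem mem_perp {T : Type*} [Fintype T] {W : Submodule (ZMod 2) (T → ZMod 2)}
    {y : T → ZMod 2} : y ∈ perp W ↔ ∀ w ∈ W, w ⬝ᵥ y = 0 := Iff.rfl

theorem nondegenerate_dotProduct (T : Type*) [Fintype T] :
    LinearMap.BilinForm.Nondegenerate
      (dotProductBilin (ZMod 2) (ZMod 2) : LinearMap.BilinForm (ZMod 2) (T → ZMod 2)) := by
  classical
  refine ⟨fun v h => ?_, fun v h => ?_⟩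
  · exact dotProduct_eq_zero v h
  · exact dotProduct_eq_zero v fun w => by rw [dotProduct_comm]; exact h w

/-- Over 𝔽₂ a subspace may meet its complement nontrivially, but nondegeneracy suffices for the
dimension formula. -/
theorem finrank_perp {T : Type*} [Fintype T] (W : Submodule (ZMod 2) (T → ZMod 2)) :
    Module.finrank (ZMod 2) (perp W) + Module.finrank (ZMod 2) W = Fintype.card T := by
  have h := LinearMap.BilinForm.finrank_orthogonal (nondegenerate_dotProduct T) W
  have h' := Submodule.finrank_le W
  rw [Module.finrank_fintype_fun_eq_card] at h h'
  change Module.finrank (ZMod 2) (perp W) = _ at h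
  omega

theorem perp_perp {T : Type*} [Fintype T] (W : Submodule (ZMod 2) (T → ZMod 2)) :
    perp (perp W) = W :=
  LinearMap.BilinForm.orthogonal_orthogonal (nondegenerate_dotProduct T)
    (fun v w h => by
      change w ⬝ᵥ v = 0
      rw [dotProduct_comm]
      exact h) W

variable {D : Type*} (M : SurfaceGraph D)

theorem vertex_eq_iff {d d' : D} : M.vertex d = M.vertex d' ↔ M.rot.SameCycle d d' :=
  Quotient.eq

theorem face_eq_iff {d d' : D} : M.face d = M.face d' ↔ M.next.SameCycle d d' :=
  Quotient.eq

theorem edge_eq_iff {d d' : D} : M.edge d = M.edge d' ↔ d' = d ∨ d' = M.rev d := by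
  refine Quotient.eq.trans ⟨?_, ?_⟩
  · rintro ⟨k, rfl⟩
    have h2 : M.rev ^ (2 : ℤ) = 1 := by
      ext d; exact M.rev_rev d
    rcases Int.even_or_odd' k with ⟨j, rfl | rfl⟩
    · left; rw [zpow_mul, h2, one_zpow, Equiv.Perm.one_apply]
    · right; rw [zpow_add, zpow_mul, h2, one_zpow, one_mul, zpow_one]
  · rintro (rfl | rfl)
    · exact Equiv.Perm.SameCycle.refl _ _
    · exact ⟨1, by simp⟩

@[simp] theorem edge_rev (d : D) : M.edge (M.rev d) = M.edge d :=
  (M.edge_eq_iff.2 (Or.inr rfl)).symm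

theorem next_apply (d : D) : M.next d = M.rot (M.rev d) := rfl

theorem face_rot (d : D) : M.face (M.rot d) = M.face (M.rev d) := by
  have : M.rot d = M.next (M.rev d) := by rw [next_apply, M.rev_rev]
  rw [this]
  exact M.face_eq_iff.2 (Equiv.Perm.sameCycle_apply_left.2 (Equiv.Perm.SameCycle.refl _ _))

instance [Finite D] : Finite M.Vertex := inferInstanceAs (Finite (Quotient _))
instance [Finite D] : Finite M.Face := inferInstanceAs (Finite (Quotient _))

/-! ### Walks -/

/-- The sum of the values of `x` along a list of darts. -/
noncomputable def walkSum (x : M.Chain) (l : List D) : ZMod 2 := (l.map fun d => x (M.edge d)).sum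

theorem walkSum_append (x : M.Chain) (l₁ l₂ : List D) :
    M.walkSum x (l₁ ++ l₂) = M.walkSum x l₁ + M.walkSum x l₂ := by
  simp [walkSum]

theorem mem_faceWalk [Finite D] {d d' : D} : d' ∈ M.faceWalk d ↔ M.face d = M.face d' := by
  rw [face_eq_iff, faceWalk, List.mem_iterate]
  constructor
  · rintro ⟨k, -, rfl⟩
    exact ⟨k, by rw [zpow_natCast, Equiv.Perm.iterate_eq_pow]⟩
  · intro h
    obtain ⟨k, -, hk⟩ := h.exists_pow_eq'
    have hpos : 0 < Function.minimalPeriod M.next d :=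
      Function.minimalPeriod_pos_of_mem_periodicPts
        (Function.Injective.mem_periodicPts M.next.injective d)
    refine ⟨k % Function.minimalPeriod M.next d, Nat.mod_lt _ hpos, ?_⟩
    rw [Function.iterate_mod_minimalPeriod_eq, Equiv.Perm.iterate_eq_pow, hk]

theorem nodup_faceWalk (d : D) : (M.faceWalk d).Nodup := by
  rw [List.nodup_iff_injective_get]
  rintro ⟨i, hi⟩ ⟨j, hj⟩ h
  simp only [faceWalk, List.length_iterate] at hi hj
  simp only [List.get_eq_getElem, faceWalk, List.getElem_iterate] at h
  exact Fin.ext (Function.iterate_injOn_Iio_minimalPeriod hi hj h)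

theorem walkSum_faceWalk [Fintype D] [DecidableEq M.Face] (x : M.Chain) (d : D) :
    M.walkSum x (M.faceWalk d) = ∑ d' with M.face d' = M.face d, x (M.edge d') := by
  classical
  have : (Finset.univ.filter fun d' => M.face d' = M.face d) = (M.faceWalk d).toFinset := by
    ext d'
    simp [mem_faceWalk, eq_comm]
  rw [this, List.sum_toFinset _ (M.nodup_faceWalk d), walkSum]

/-- A backtracking counts the same edge twice, which is zero modulo 2, and a tour of an inner face
contributes zero by `hx`. -/
theorem Homotopic.walkSum_eq [Fintype D] [DecidableEq M.Face] {A : Set M.Edge} {x : M.Chain}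
    (hx : ∀ p, (∀ d, M.face d = p → M.edge d ∈ A) → ∑ d with M.face d = p, x (M.edge d) = 0)
    {l l' : List D} (h : M.Homotopic A l l') : M.walkSum x l = M.walkSum x l' := by
  induction h with
  | refl l => rfl
  | symm _ ih => exact ih.symm
  | trans _ _ ih₁ ih₂ => exact ih₁.trans ih₂
  | backtrack l₁ l₂ d _ =>
    rw [walkSum_append, walkSum_append, walkSum_append]
    simp [walkSum, CharTwo.add_self_eq_zero]
  | face l₁ l₂ d hw =>
    rw [walkSum_append, walkSum_append, walkSum_append, walkSum_faceWalk, hx, add_zero]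
    intro d' hd'
    exact hw.1 d' (by simp [mem_faceWalk, hd'])

theorem IsWalk.append {A : Set M.Edge} {l₁ l₂ : List D} (h₁ : M.IsWalk A l₁) (h₂ : M.IsWalk A l₂)
    (h : ∀ d ∈ l₁.getLast?, ∀ d' ∈ l₂.head?, M.vertex d' = M.vertex (M.rev d)) :
    M.IsWalk A (l₁ ++ l₂) := by
  refine ⟨fun d hd => ?_, List.isChain_append.2 ⟨h₁.2, h₂.2, h⟩⟩
  rcases List.mem_append.1 hd with hd | hd
  exacts [h₁.1 d hd, h₂.1 d hd]

/-- On a disc, a vector orthogonal to the interior faces is the coboundary of a vertex potential. -/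
theorem IsDisc.exists_potential [Fintype D] [DecidableEq M.Face] {R : Set M.Face} {A : Set M.Edge}
    (hA : M.IsDisc R A) {x : M.Chain}
    (hx : ∀ p, (∀ d, M.face d = p → M.edge d ∈ A) → ∑ d with M.face d = p, x (M.edge d) = 0) :
    ∃ φ : M.Vertex → ZMod 2, ∀ d, M.edge d ∈ A →
      x (M.edge d) = φ (M.vertex d) + φ (M.vertex (M.rev d)) := by
  classical
  obtain ⟨e₀, he₀⟩ := hA.nonempty
  obtain ⟨d₀, rfl⟩ := Quotient.exists_rep e₀
  change M.edge d₀ ∈ A at he₀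
  -- Walks from the base dart `d₀` to the starting vertex of `d`; the potential will be the sum of
  -- `x` along such a walk.
  let P : D → List D → Prop := fun d l => M.IsWalk A l ∧ l.head? = some d₀ ∧
    ∃ d' ∈ l.getLast?, M.vertex (M.rev d') = M.vertex d
  have hP : ∀ d, M.edge d ∈ A → ∃ l, P d l := by
    intro d hd
    obtain ⟨l, hl, hh, ht⟩ := hA.pathConnected d₀ (M.rev d) he₀ (by simpa using hd)
    exact ⟨l, hl, hh, M.rev d, ht, by rw [M.rev_rev]⟩
  have huniq : ∀ d l l', M.edge d ∈ A → P d l → P d l' → M.walkSum x l = M.walkSum x l' := by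
    intro d l l' hd hl hl'
    obtain ⟨r, hr, hrh, hrt⟩ := hA.pathConnected d (M.rev d₀) hd (by simpa using he₀)
    -- Closing every such walk by the same return path `r` gives a null-homotopic loop, so the sum
    -- along `l` is determined by `r`.
    have key : ∀ l, P d l → M.walkSum x l + M.walkSum x r = 0 := by
      rintro l ⟨hl, hh, d', hd', hv⟩
      rw [← walkSum_append]
      have hclosed : M.IsClosedWalk A (l ++ r) := by
        refine ⟨hl.append M hr fun a ha b hb => ?_, fun a ha b hb => ?_⟩
        · obtain rfl := Option.mem_unique hd' ha
          obtain rfl : d = b := by simpa [hrh] using hb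
          exact hv.symm
        · obtain rfl : M.rev d₀ = a := by simpa [List.getLast?_append, hrt] using ha
          obtain rfl : d₀ = b := by simpa [List.head?_append, hh] using hb
          rw [M.rev_rev]
      rw [(hA.simplyConnected _ hclosed).walkSum_eq M hx]
      rfl
    have h₁ := key l hl
    have h₂ := key l' hl'
    exact add_right_cancel (h₁.trans h₂.symm)
  choose! L hL using hP
  -- A dart of A at each touched vertex; the default `d₀` is irrelevant, since the potential is only
  -- used at ends of edges of A.
  let s : M.Vertex → D := fun v => if h : ∃ d, M.vertex d = v ∧ M.edge d ∈ A then h.choose else d₀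
  have hs : ∀ d, M.edge d ∈ A →
      M.vertex (s (M.vertex d)) = M.vertex d ∧ M.edge (s (M.vertex d)) ∈ A := by
    intro d hd
    have h : ∃ d', M.vertex d' = M.vertex d ∧ M.edge d' ∈ A := ⟨d, rfl, hd⟩
    simp only [s, dif_pos h]
    exact h.choose_spec
  have hPc : ∀ {d d' l}, M.vertex d = M.vertex d' → P d l → P d' l := by
    intro d d' l h hl
    simpa only [P, h] using hl
  refine ⟨fun v => M.walkSum x (L (s v)), fun d hd => ?_⟩
  have hd' : M.edge (M.rev d) ∈ A := by simpa using hd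
  have hu := hPc (hs d hd).1 (hL _ (hs d hd).2)
  have hv := hPc (hs _ hd').1 (hL _ (hs _ hd').2)
  have hu' : P (M.rev d) (L (s (M.vertex d)) ++ [d]) := by
    obtain ⟨h₁, h₂, a, ha, hav⟩ := hu
    refine ⟨h₁.append M ⟨by simpa using hd, List.isChain_singleton _⟩ fun b hb c hc => ?_, ?_, d,
      by simp, rfl⟩
    · obtain rfl := Option.mem_unique ha hb
      obtain rfl : d = c := by simpa using hc
      exact hav.symm
    · simp [List.head?_append, h₂]
  have h := huniq _ _ _ hd' hu' hv
  rw [walkSum_append] at h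
  dsimp only
  rw [← h, ← add_assoc, CharTwo.add_self_eq_zero, zero_add]
  simp [walkSum]

/-! ### Incidence maps -/

section Incidence

variable [Fintype D]

/-- The chain in which every dart `d` contributes `g d` to its edge. -/
noncomputable def flow : (D → ZMod 2) →ₗ[ZMod 2] M.Chain where
  toFun g := ∑ d, Pi.single (M.edge d) (g d)
  map_add' g h := by simp [Pi.single_add, Finset.sum_add_distrib]
  map_smul' c g := by simp [Finset.smul_sum, ← Pi.single_smul]

theorem flow_dotProduct (g : D → ZMod 2) (c : M.Chain) :
    M.flow g ⬝ᵥ c = ∑ d, g d * c (M.edge d) := by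
  simp [flow, sum_dotProduct]

theorem flow_apply (g : D → ZMod 2) (d : D) : M.flow g (M.edge d) = g d + g (M.rev d) := by
  classical
  have h : M.flow g (M.edge d) = ∑ d', if M.edge d = M.edge d' then g d' else 0 := by
    simp [flow, Finset.sum_apply, Pi.single_apply]
  rw [h, ← Finset.sum_filter]
  have : (Finset.univ.filter fun d' => M.edge d = M.edge d') = {d, M.rev d} := by
    ext d'; simp [edge_eq_iff]
  rw [this, Finset.sum_pair (M.rev_ne d).symm]

theorem star_eq_flow [DecidableEq M.Vertex] (s : M.Vertex) :
    M.star s = M.flow fun d => if M.vertex d = s then 1 else 0 := by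
  rw [star, flow, Finset.sum_filter]
  refine Finset.sum_congr (by congr) fun d _ => ?_
  split_ifs with h <;> simp [h]

theorem dotProduct_plaquette [DecidableEq M.Face] (c : M.Chain) (p : M.Face) :
    c ⬝ᵥ M.plaquette p = ∑ d with M.face d = p, c (M.edge d) := by
  rw [plaquette, dotProduct_sum]
  refine Finset.sum_congr (by congr) fun d _ => ?_
  simp

/-- A sum of stars is the coboundary of the indicator of its vertices; a loop cancels because both
of its darts contribute. -/
theorem dualBoundaries_eq_range :
    M.dualBoundaries = LinearMap.range (M.flow ∘ₗ LinearMap.funLeft (ZMod 2) (ZMod 2) M.vertex) := by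
  classical
  have : Fintype M.Vertex := Fintype.ofFinite _
  have hstar : ∀ s, M.star s =
      (M.flow ∘ₗ LinearMap.funLeft (ZMod 2) (ZMod 2) M.vertex) (Pi.single s 1) := by
    intro s
    rw [star_eq_flow]
    refine congrArg M.flow (funext fun d => ?_)
    simp [LinearMap.funLeft_apply, Pi.single_apply]
  refine le_antisymm (Submodule.span_le.2 ?_) ?_
  · rintro _ ⟨s, rfl⟩
    exact ⟨_, (hstar s).symm⟩
  · rintro _ ⟨φ, rfl⟩
    rw [pi_eq_sum_univ' φ, map_sum]
    refine Submodule.sum_mem _ fun s _ => ?_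
    rw [map_smul, ← hstar]
    exact Submodule.smul_mem _ _ (Submodule.subset_span ⟨s, rfl⟩)

variable {Q : Type*} (q : D → Q) (A : Set M.Edge)

/-- The incidence map from the cells (vertices or faces) in `T` to the edges in `A`. -/
noncomputable def incidence (T : Set Q) : (T → ZMod 2) →ₗ[ZMod 2] (A → ZMod 2) :=
  restrict A ∘ₗ M.flow ∘ₗ LinearMap.funLeft (ZMod 2) (ZMod 2) q ∘ₗ extend T

theorem incidence_apply (T : Set Q) (φ : T → ZMod 2) (d : D) (hd : M.edge d ∈ A) :
    M.incidence q A T φ ⟨M.edge d, hd⟩ = extend T φ (q d) + extend T φ (q (M.rev d)) :=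
  M.flow_apply _ d

/-- Summation by parts: the transpose of the incidence map sums a vector over the darts of each
cell. -/
theorem mem_perp_range_incidence [DecidableEq Q] [Finite Q] {T : Set Q} {y : A → ZMod 2} :
    y ∈ perp (LinearMap.range (M.incidence q A T)) ↔
      ∀ t ∈ T, ∑ d with q d = t, extend A y (M.edge d) = 0 := by
  classical
  have : Fintype Q := Fintype.ofFinite _
  have hdot : ∀ φ, M.incidence q A T φ ⬝ᵥ y =
      ∑ t, extend T φ t * ∑ d with q d = t, extend A y (M.edge d) := by
    intro φ
    have h₁ : ∀ c : M.Chain, restrict A c ⬝ᵥ y = c ⬝ᵥ extend A y := by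
      intro c
      simp only [dotProduct]
      rw [← Finset.sum_subset (Finset.subset_univ (Finset.univ.filter (· ∈ A)))]
      · rw [← Finset.sum_subtype_eq_sum_filter]
        rw [Finset.subtype_univ]
        refine Finset.sum_congr (by congr!) fun i _ => ?_
        rw [restrict_apply, extend_apply_mem y i.2]
      · intro i _ hi
        rw [extend_apply_notMem y (by simpa using hi), mul_zero]
    change restrict A (M.flow _) ⬝ᵥ y = _
    rw [h₁, flow_dotProduct, ← Finset.sum_fiberwise Finset.univ q]
    refine Finset.sum_congr rfl fun t _ => ?_
    rw [Finset.mul_sum]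
    refine Finset.sum_congr rfl fun d hd => ?_
    rw [← (Finset.mem_filter.1 hd).2]
    rfl
  rw [mem_perp]
  constructor
  · intro h t ht
    have := h _ ⟨Pi.single ⟨t, ht⟩ 1, rfl⟩
    rw [hdot, Finset.sum_eq_single t] at this
    · simpa [extend_apply_mem _ ht] using this
    · intro t' _ hne
      by_cases ht' : t' ∈ T
      · rw [extend_apply_mem _ ht', Pi.single_eq_of_ne, zero_mul]
        simpa using hne
      · rw [extend_apply_notMem _ ht', zero_mul]
    · simp
  · rintro h _ ⟨φ, rfl⟩
    rw [hdot]
    refine Finset.sum_eq_zero fun t _ => ?_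
    by_cases ht : t ∈ T
    · rw [h t ht, mul_zero]
    · rw [extend_apply_notMem _ ht, zero_mul]

/-- The cells incident to an edge of `A`. -/
def touched : Set Q := {t | ∃ d, q d = t ∧ M.edge d ∈ A}

/-- The cells with an edge in `A` all of whose edges are in `A`. -/
def inner : Set Q := {t | t ∈ M.touched q A ∧ ∀ d, q d = t → M.edge d ∈ A}

/-- The cells with an edge in `A` and an edge outside `A`. -/
def mixed : Set Q := {t | t ∈ M.touched q A ∧ ∃ d, q d = t ∧ M.edge d ∉ A}

theorem card_inner_add_card_mixed [Finite Q] :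
    Nat.card (M.inner q A) + (M.mixed q A).ncard = Nat.card (M.touched q A) := by
  rw [Nat.card_coe_set_eq, Nat.card_coe_set_eq, ← Set.ncard_union_eq]
  · congr 1
    ext t
    simp only [inner, mixed, Set.mem_union, Set.mem_ofPred_eq]
    constructor
    · rintro (h | h) <;> exact h.1
    · intro h
      by_cases h' : ∀ d, q d = t → M.edge d ∈ A
      · exact Or.inl ⟨h, h'⟩
      · push Not at h'
        exact Or.inr ⟨h, h'⟩
  · rw [Set.disjoint_left]
    rintro t ⟨-, h⟩ ⟨-, d, hd, hd'⟩
    exact hd' (h d hd)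

/-- The cells incident to `A` are connected to each other through the edges of `A`. -/
def CellsConnected : Prop :=
  ∀ ψ : Q → ZMod 2, (∀ d, M.edge d ∈ A → ψ (q d) = ψ (q (M.rev d))) →
    ∀ d d', M.edge d ∈ A → M.edge d' ∈ A → ψ (q d) = ψ (q d')

variable {q A}

theorem extend_eq_of_incidence_eq_zero {T : Set Q} {φ : T → ZMod 2}
    (hφ : M.incidence q A T φ = 0) (d : D) (hd : M.edge d ∈ A) :
    extend T φ (q d) = extend T φ (q (M.rev d)) := by
  have := congrFun hφ ⟨M.edge d, hd⟩
  rw [incidence_apply] at this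
  exact CharTwo.add_eq_zero.1 this

/-- A kernel element, extended by zero, is constant on the touched cells. It vanishes at the touched
cell outside `T`, so the map is injective. -/
theorem finrank_range_incidence_of_ssubset [Finite Q] (hq : M.CellsConnected q A) {T : Set Q}
    (hT : T ⊆ M.touched q A) (hne : ∃ t ∈ M.touched q A, t ∉ T) :
    Module.finrank (ZMod 2) (LinearMap.range (M.incidence q A T)) = Nat.card T := by
  classical
  have : Fintype T := Fintype.ofFinite _
  rw [LinearMap.finrank_range_of_inj, Module.finrank_fintype_fun_eq_card,
    Nat.card_eq_fintype_card]
  rw [← LinearMap.ker_eq_bot, LinearMap.ker_eq_bot']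
  intro φ hφ
  obtain ⟨_, ⟨d', rfl, hd'⟩, hnot⟩ := hne
  ext ⟨t, ht⟩
  obtain ⟨d, rfl, hd⟩ := hT ht
  have h := hq _ (M.extend_eq_of_incidence_eq_zero hφ) d d' hd hd'
  rw [extend_apply_mem φ ht, extend_apply_notMem φ hnot] at h
  exact h

/-- With all touched cells present the kernel is exactly the line of constants, which costs one
dimension. -/
theorem finrank_range_incidence_touched [Finite Q] (hq : M.CellsConnected q A)
    (hA : A.Nonempty) :
    Module.finrank (ZMod 2) (LinearMap.range (M.incidence q A (M.touched q A))) + 1 =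
      Nat.card (M.touched q A) := by
  classical
  obtain ⟨e₀, he₀⟩ := hA
  obtain ⟨d₀, rfl⟩ := Quotient.exists_rep e₀
  change M.edge d₀ ∈ A at he₀
  have : Fintype (M.touched q A) := Fintype.ofFinite _
  have h := LinearMap.finrank_range_add_finrank_ker (M.incidence q A (M.touched q A))
  rw [Module.finrank_fintype_fun_eq_card, ← Nat.card_eq_fintype_card] at h
  have htouch : ∀ d, M.edge d ∈ A → q d ∈ M.touched q A := fun d hd => ⟨d, rfl, hd⟩
  have hker : LinearMap.ker (M.incidence q A (M.touched q A)) =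
      Submodule.span (ZMod 2) {fun _ => 1} := by
    ext φ
    rw [LinearMap.mem_ker, Submodule.mem_span_singleton]
    constructor
    · intro hφ
      refine ⟨φ ⟨q d₀, htouch d₀ he₀⟩, ?_⟩
      ext ⟨t, ht⟩
      obtain ⟨d, rfl, hd⟩ := id ht
      have h := hq _ (M.extend_eq_of_incidence_eq_zero hφ) d d₀ hd he₀
      rw [extend_apply_mem φ ht, extend_apply_mem φ (htouch d₀ he₀)] at h
      simpa using h.symm
    · rintro ⟨c, rfl⟩
      ext ⟨e, he⟩
      obtain ⟨d, rfl⟩ := Quotient.exists_rep e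
      change M.edge d ∈ A at he
      refine (M.incidence_apply q A _ _ d he).trans ?_
      rw [extend_apply_mem _ (htouch d he),
        extend_apply_mem _ (htouch (M.rev d) (by simpa using he))]
      exact CharTwo.add_self_eq_zero _
  rw [hker, finrank_span_singleton] at h
  · exact h
  · intro h0
    exact one_ne_zero (congrFun h0 ⟨q d₀, htouch d₀ he₀⟩)

theorem exists_exit (π : Equiv.Perm D) {d d' : D} (h : π.SameCycle d d') (hd : M.edge d ∈ A)
    (hd' : M.edge d' ∉ A) :
    ∃ a, π.SameCycle d a ∧ M.edge a ∈ A ∧ M.edge (π a) ∉ A := by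
  by_contra! hcon
  obtain ⟨k, -, rfl⟩ := h.exists_pow_eq'
  refine hd' ?_
  clear hd' h
  induction k with
  | zero => exact hd
  | succ k ih =>
    rw [pow_succ', Equiv.Perm.mul_apply]
    exact hcon _ ⟨k, by simp⟩ ih

/-- Turning around a mixed cell, one leaves A at some dart, and by the sector condition at only one.
-/
theorem ncard_mixed (π : Equiv.Perm D) (hq : ∀ d d', q d = q d' ↔ π.SameCycle d d')
    (hsector : ∀ d d', q d = q d' → M.edge d ∈ A → M.edge (π d) ∉ A → M.edge d' ∈ A →
      M.edge (π d') ∉ A → d = d') :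
    (M.mixed q A).ncard = {d | M.edge d ∈ A ∧ M.edge (π d) ∉ A}.ncard := by
  rw [← Set.InjOn.ncard_image (f := q) fun d hd d' hd' h =>
    hsector d d' h hd.1 hd.2 hd'.1 hd'.2]
  congr 1
  ext t
  constructor
  · rintro ⟨⟨d, rfl, hd⟩, d', hd', hd'A⟩
    obtain ⟨a, ha, h⟩ := M.exists_exit π ((hq _ _).1 hd'.symm) hd hd'A
    exact ⟨a, h, ((hq _ _).2 ha).symm⟩
  · rintro ⟨d, ⟨h₁, h₂⟩, rfl⟩
    exact ⟨⟨d, rfl, h₁⟩, π d, (hq _ _).2 (Equiv.Perm.sameCycle_apply_left.2 (.refl _ _)), h₂⟩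

end Incidence

/-! ### Discs -/

namespace IsDisc

variable {D : Type*} {M : SurfaceGraph D} {R : Set M.Face} {A : Set M.Edge}

theorem cellsConnected_vertex (hA : M.IsDisc R A) : M.CellsConnected M.vertex A := by
  intro ψ hψ d d' hd hd'
  obtain ⟨l, hl, hh, ht⟩ := hA.pathConnected d d' hd hd'
  clear hd
  induction l generalizing d with
  | nil => simp at hh
  | cons a l ih =>
    obtain rfl : a = d := by simpa using hh
    cases l with
    | nil =>
      obtain rfl : a = d' := by simpa using ht
      rfl
    | cons b l =>
      have hc := List.isChain_cons_cons.1 hl.2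
      rw [hψ a (hl.1 a (by simp)), ← hc.1]
      exact ih b ⟨fun c hc' => hl.1 c (List.mem_cons_of_mem _ hc'), hc.2⟩ rfl
        (by simpa using ht)

/-- Going around a vertex of the region, one stays in the region forever or leaves it at some
corner; up to there all faces are connected through the region. -/
theorem sector_alternative {ψ : M.Face → ZMod 2}
    (hψ : ∀ d, M.edge d ∈ A → ψ (M.face d) = ψ (M.face (M.rev d))) {d : D} (hd : M.edge d ∈ A) :
    (∀ k : ℕ, M.edge ((M.rot ^ k) d) ∈ A ∧ ψ (M.face ((M.rot ^ k) d)) = ψ (M.face d)) ∨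
      ∃ a, M.vertex a = M.vertex d ∧ M.edge a ∈ A ∧ M.edge (M.rot a) ∉ A ∧
        ψ (M.face a) = ψ (M.face d) := by
  by_cases h : ∃ a, M.vertex a = M.vertex d ∧ M.edge a ∈ A ∧ M.edge (M.rot a) ∉ A ∧
      ψ (M.face a) = ψ (M.face d)
  · exact Or.inr h
  · refine Or.inl fun k => ?_
    induction k with
    | zero => exact ⟨hd, rfl⟩
    | succ k ih =>
      rw [pow_succ', Equiv.Perm.mul_apply]
      refine ⟨by_contra fun hk => h ⟨_, ?_, ih.1, hk, ih.2⟩, ?_⟩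
      · exact (M.vertex_eq_iff.2 ⟨k, by simp⟩).symm
      · rw [face_rot, ← hψ _ ih.1, ih.2]

theorem cellsConnected_face [Finite D] (hA : M.IsDisc R A) : M.CellsConnected M.face A := by
  intro ψ hψ d d' hd hd'
  -- Turning from `a` or from `b`, either one reaches the other dart without leaving A, or both
  -- reach an exit, and the vertex has only one exit.
  have hcorner : ∀ a b, M.edge a ∈ A → M.edge b ∈ A → M.vertex a = M.vertex b →
      ψ (M.face a) = ψ (M.face b) := by
    intro a b ha hb hab
    rcases sector_alternative hψ ha with h | ⟨a', ha', h₁, h₂, h₃⟩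
    · obtain ⟨k, -, rfl⟩ := (M.vertex_eq_iff.1 hab).exists_pow_eq'
      exact (h k).2.symm
    · rcases sector_alternative hψ hb with h | ⟨b', hb', h₁', h₂', h₃'⟩
      · obtain ⟨k, -, rfl⟩ := (M.vertex_eq_iff.1 hab.symm).exists_pow_eq'
        exact (h k).2
      · rw [← h₃, ← h₃', hA.vertex_sector a' b' (by rw [ha', hb', hab]) h₁ h₂ h₁' h₂']
  obtain ⟨l, hl, hh, ht⟩ := hA.pathConnected d d' hd hd'
  clear hd
  induction l generalizing d with
  | nil => simp at hh
  | cons a l ih =>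
    obtain rfl : a = d := by simpa using hh
    cases l with
    | nil =>
      obtain rfl : a = d' := by simpa using ht
      rfl
    | cons b l =>
      have hc := List.isChain_cons_cons.1 hl.2
      have hb : M.edge b ∈ A := hl.1 b (by simp)
      have ha : M.edge a ∈ A := hl.1 a (by simp)
      rw [hψ a ha, ← hcorner b _ hb (by simpa using ha) hc.1]
      exact ih b ⟨fun c hc' => hl.1 c (List.mem_cons_of_mem _ hc'), hc.2⟩ rfl
        (by simpa using ht)

theorem mixed_face_eq (hA : M.IsDisc R A) [Fintype D] :
    {p : M.Face | p ∉ R ∧ (∃ d, M.face d = p ∧ M.edge d ∈ A) ∧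
      ∃ d, M.face d = p ∧ M.edge d ∉ A} = M.mixed M.face A := by
  ext p
  refine ⟨fun h => h.2, fun h => ⟨?_, h⟩⟩
  obtain ⟨⟨d, rfl, hd⟩, -⟩ := h
  exact hA.interior d hd

theorem ncard_mixed_face [Fintype D] (hA : M.IsDisc R A) :
    (M.mixed M.face A).ncard = M.crossing R A := by
  rw [crossing, hA.mixed_face_eq]

/-- Since `next` is `rot` after `rev`, reversing darts matches the exits around faces with those
around vertices. -/
theorem ncard_mixed_face_eq_exits [Fintype D] (hA : M.IsDisc R A) :
    (M.mixed M.face A).ncard = {d | M.edge d ∈ A ∧ M.edge (M.rot d) ∉ A}.ncard := by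
  rw [M.ncard_mixed M.next (fun _ _ => M.face_eq_iff) hA.face_sector]
  refine Set.ncard_congr (fun d _ => M.rev d) (fun d hd => ?_) (fun d d' _ _ h => M.rev.injective h)
    fun d hd => ⟨M.rev d, ?_, M.rev_rev d⟩
  · exact ⟨by simpa using hd.1, hd.2⟩
  · refine ⟨by simpa using hd.1, ?_⟩
    rw [next_apply, M.rev_rev]
    exact hd.2

theorem ncard_mixed_vertex [Fintype D] (hA : M.IsDisc R A) :
    (M.mixed M.vertex A).ncard = M.crossing R A := by
  rw [M.ncard_mixed M.rot (fun _ _ => M.vertex_eq_iff) hA.vertex_sector, ← hA.ncard_mixed_face,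
    hA.ncard_mixed_face_eq_exits]

theorem one_le_crossing [Fintype D] (hA : M.IsDisc R A) : 1 ≤ M.crossing R A := by
  rw [← hA.ncard_mixed_face, hA.ncard_mixed_face_eq_exits, Nat.one_le_iff_ne_zero, Ne,
    Set.ncard_eq_zero]
  intro h
  obtain ⟨e, he⟩ := hA.nonempty
  obtain ⟨d, rfl⟩ := Quotient.exists_rep e
  refine hA.ne_univ (Set.eq_univ_of_forall fun e' => ?_)
  obtain ⟨d', rfl⟩ := Quotient.exists_rep e'
  -- Without exits A is closed under `rot` and `rev`, so by connectedness it would contain every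
  -- edge.
  have key : ∀ d', Relation.ReflTransGen (fun x y => y = M.rot x ∨ y = M.rev x) d d' →
      M.edge d' ∈ A := by
    intro d' hd'
    induction hd' with
    | refl => exact he
    | tail _ h' ih =>
      rcases h' with rfl | rfl
      · exact by_contra fun hc => Set.eq_empty_iff_forall_notMem.1 h _ ⟨ih, hc⟩
      · simpa using ih
  exact key d' (M.connected d d')

theorem inner_notMem (hA : M.IsDisc R A) {p : M.Face} (hp : p ∈ M.inner M.face A) : p ∉ R := by
  obtain ⟨⟨d, rfl, hd⟩, -⟩ := hp
  exact hA.interior d hd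

theorem exists_touched_notMem_inner {Q : Type*} [Finite Q] {q : D → Q}
    (h : 1 ≤ (M.mixed q A).ncard) : ∃ t ∈ M.touched q A, t ∉ M.inner q A := by
  obtain ⟨t, ht⟩ := Set.nonempty_of_ncard_ne_zero (Nat.one_le_iff_ne_zero.1 h)
  obtain ⟨d, hd, hdA⟩ := ht.2
  exact ⟨t, ht.1, fun hi => hdA (hi.2 d hd)⟩

/-! ### Dimension count on the disc -/

section Finrank

variable [Fintype D]

/-- Stars of untouched vertices vanish on A, so only touched vertices matter. -/
theorem map_restrict_dualBoundaries :
    M.dualBoundaries.map (restrict A) =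
      LinearMap.range (M.incidence M.vertex A (M.touched M.vertex A)) := by
  rw [dualBoundaries_eq_range]
  have key : ∀ φ : M.Vertex → ZMod 2,
      restrict A ((M.flow ∘ₗ LinearMap.funLeft (ZMod 2) (ZMod 2) M.vertex) φ) =
        M.incidence M.vertex A (M.touched M.vertex A) (restrict _ φ) := by
    intro φ
    ext ⟨e, he⟩
    obtain ⟨d, rfl⟩ := Quotient.exists_rep e
    change M.edge d ∈ A at he
    refine (M.flow_apply _ d).trans (Eq.trans ?_ (M.incidence_apply _ _ _ _ d he).symm)
    have h₁ : M.vertex d ∈ M.touched M.vertex A := ⟨d, rfl, he⟩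
    have h₂ : M.vertex (M.rev d) ∈ M.touched M.vertex A := ⟨M.rev d, rfl, by simpa using he⟩
    rw [extend_apply_mem _ h₁, extend_apply_mem _ h₂]
    rfl
  apply le_antisymm
  · rintro _ ⟨_, ⟨φ, rfl⟩, rfl⟩
    exact ⟨_, (key φ).symm⟩
  · rintro _ ⟨φ, rfl⟩
    refine ⟨_, ⟨extend _ φ, rfl⟩, ?_⟩
    rw [key, restrict_extend]

/-- The star of an inner vertex lies entirely inside A. This is only a lower bound for K;
`finrank_facts` shows that it is sharp. -/
theorem range_incidence_inner_le :
    LinearMap.range (M.incidence M.vertex A (M.inner M.vertex A)) ≤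
      M.dualBoundaries.comap (extend A) := by
  rintro _ ⟨φ, rfl⟩
  rw [Submodule.mem_comap, dualBoundaries_eq_range]
  refine ⟨extend _ φ, ?_⟩
  ext e
  obtain ⟨d, rfl⟩ := Quotient.exists_rep e
  change _ = extend A _ (M.edge d)
  by_cases he : M.edge d ∈ A
  · rw [extend_apply_mem _ he]
    exact (M.flow_apply _ d).trans (M.incidence_apply _ _ _ _ d he).symm
  · rw [extend_apply_notMem _ he]
    refine (M.flow_apply _ d).trans ?_
    change extend _ φ (M.vertex d) + extend _ φ (M.vertex (M.rev d)) = 0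
    rw [extend_apply_notMem _ fun h => he (h.2 d rfl),
      extend_apply_notMem _ fun h => he (by simpa using h.2 (M.rev d) rfl), add_zero]

/-- For a vector supported in A only touched faces impose a condition, and none of them is removed.
-/
theorem comap_extend_dualCycles (hA : M.IsDisc R A) :
    (M.dualCycles R).comap (extend A) =
      perp (LinearMap.range (M.incidence M.face A (M.touched M.face A))) := by
  classical
  ext y
  rw [mem_perp_range_incidence, Submodule.mem_comap]
  change (∀ p ∉ R, extend A y ⬝ᵥ M.plaquette p = 0) ↔ _
  simp only [dotProduct_plaquette]
  constructor
  · rintro h _ ⟨d, rfl, hd⟩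
    exact h _ (hA.interior d hd)
  · intro h p _
    by_cases hp : p ∈ M.touched M.face A
    · exact h p hp
    · refine Finset.sum_eq_zero fun d hd => extend_apply_notMem _ fun hdA => ?_
      exact hp ⟨d, (Finset.mem_filter.1 hd).2, hdA⟩

theorem restrict_mem_perp (hA : M.IsDisc R A) {x : M.Chain} (hx : x ∈ M.dualCycles R) :
    restrict A x ∈ perp (LinearMap.range (M.incidence M.face A (M.inner M.face A))) := by
  classical
  rw [mem_perp_range_incidence]
  intro p hp
  rw [← hx p (hA.inner_notMem hp), dotProduct_plaquette]
  refine Finset.sum_congr rfl fun d hd => ?_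
  rw [extend_apply_mem _ (hp.2 d (Finset.mem_filter.1 hd).2)]
  rfl

/-- The potential on the disc, used as a vertex function on the whole graph, gives an element of S
with the prescribed restriction. -/
theorem perp_le_map_restrict (hA : M.IsDisc R A) :
    perp (LinearMap.range (M.incidence M.face A (M.inner M.face A))) ≤
      M.dualBoundaries.map (restrict A) := by
  classical
  intro y hy
  rw [mem_perp_range_incidence] at hy
  have hinner : ∀ p, (∀ d, M.face d = p → M.edge d ∈ A) →
      ∑ d with M.face d = p, extend A y (M.edge d) = 0 := by
    intro p hp
    obtain ⟨d, rfl⟩ := Quotient.exists_rep p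
    exact hy _ ⟨⟨d, rfl, hp d rfl⟩, hp⟩
  obtain ⟨φ, hφ⟩ := hA.exists_potential M hinner
  rw [dualBoundaries_eq_range]
  refine ⟨_, ⟨φ, rfl⟩, ?_⟩
  ext ⟨e, he⟩
  obtain ⟨d, rfl⟩ := Quotient.exists_rep e
  change M.edge d ∈ A at he
  have h := hφ d he
  rw [extend_apply_mem _ he] at h
  exact (M.flow_apply _ d).trans h.symm

theorem map_restrict_eq_perp (hA : M.IsDisc R A) (hSX : M.dualBoundaries ≤ M.dualCycles R) :
    M.dualBoundaries.map (restrict A) =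
      perp (LinearMap.range (M.incidence M.face A (M.inner M.face A))) := by
  refine le_antisymm ?_ hA.perp_le_map_restrict
  rintro _ ⟨s, hs, rfl⟩
  exact hA.restrict_mem_perp (hSX hs)

theorem finrank_facts (hA : M.IsDisc R A) (hSX : M.dualBoundaries ≤ M.dualCycles R) :
    M.dualBoundaries.comap (extend A) = (M.dualCycles R).comap (extend A) ∧
      Module.finrank (ZMod 2) (M.dualBoundaries.map (restrict A)) =
        M.crossing R A - 1 + Module.finrank (ZMod 2) (M.dualBoundaries.comap (extend A)) := by
  have hn := hA.one_le_crossing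
  have hV := hA.ncard_mixed_vertex
  have hF := hA.ncard_mixed_face
  have c₁ := M.card_inner_add_card_mixed M.vertex A
  have c₂ := M.card_inner_add_card_mixed M.face A
  have h₁ := M.finrank_range_incidence_touched hA.cellsConnected_vertex hA.nonempty
  have h₂ := M.finrank_range_incidence_touched hA.cellsConnected_face hA.nonempty
  have h₃ := M.finrank_range_incidence_of_ssubset hA.cellsConnected_face
    (T := M.inner M.face A) (fun _ h => h.1) (exists_touched_notMem_inner (hF ▸ hn))
  have h₄ := M.finrank_range_incidence_of_ssubset hA.cellsConnected_vertex
    (T := M.inner M.vertex A) (fun _ h => h.1) (exists_touched_notMem_inner (hV ▸ hn))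
  have p₁ := finrank_perp (LinearMap.range (M.incidence M.face A (M.inner M.face A)))
  have p₂ := finrank_perp (LinearMap.range (M.incidence M.face A (M.touched M.face A)))
  -- Write v, f for numbers of vertices and faces, with t for touched and i for inner. Now `p₁` is
  -- the Euler relation (v_t - 1) + f_i = |A|, and `p₂` gives the elements of X supported in A
  -- dimension |A| - (f_t - 1) = v_t - n_AB = v_i. The inner stars already span v_i dimensions, so
  -- the inclusions K ≤ X ∩ 𝔽₂^A and inner stars ≤ K are equalities.
  rw [← hA.map_restrict_eq_perp hSX, map_restrict_dualBoundaries] at p₁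
  rw [← hA.comap_extend_dualCycles] at p₂
  have hle : M.dualBoundaries.comap (extend A) ≤ (M.dualCycles R).comap (extend A) :=
    Submodule.comap_mono hSX
  have f₁ := Submodule.finrank_mono (range_incidence_inner_le (M := M) (A := A))
  have f₂ := Submodule.finrank_mono hle
  refine ⟨Submodule.eq_of_le_of_finrank_le hle ?_, ?_⟩
  · omega
  · rw [map_restrict_dualBoundaries]
    omega

theorem card_map_restrict (hA : M.IsDisc R A) (hSX : M.dualBoundaries ≤ M.dualCycles R) :
    2 ^ (M.crossing R A - 1) * Nat.card (M.dualBoundaries.comap (extend A)) =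
      Nat.card (M.dualBoundaries.map (restrict A)) := by
  rw [Module.natCard_eq_pow_finrank (K := ZMod 2) (V := M.dualBoundaries.comap (extend A)),
    Module.natCard_eq_pow_finrank (K := ZMod 2) (V := M.dualBoundaries.map (restrict A)),
    (hA.finrank_facts hSX).2, Nat.card_zmod, pow_add]

end Finrank

end IsDisc

/-! ### Ground states -/

section GroundStates

theorem stringZ_apply {ι : Type*} [DecidableEq ι] [Fintype ι] (z : ι → ZMod 2) (v : Qubits ι)
    (s : ι → ZMod 2) : stringZ z v s = (if z ⬝ᵥ s = 0 then 1 else -1) * v s := by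
  classical
  have sign : ∀ a b : ZMod 2, (if a = 0 then (1 : ℂ) else -1) * (if b = 0 then 1 else -1) =
      if a + b = 0 then 1 else -1 := by
    have h : ∀ a : ZMod 2, a = 0 ∨ a = 1 := by decide
    intro a b
    rcases h a with rfl | rfl <;> rcases h b with rfl | rfl <;>
      simp [CharTwo.add_self_eq_zero]
  have hzs : z ⬝ᵥ s = ∑ i with z i ≠ 0, s i := by
    rw [Finset.sum_filter]
    refine Finset.sum_congr rfl fun i _ => ?_
    have : ∀ a b : ZMod 2, a * b = if a ≠ 0 then b else 0 := by decide
    exact this _ _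
  rw [hzs, stringZ]
  have key : ∀ (t : Finset ι) (h), (t.noncommProd pauliZ h) v s =
      (if ∑ i ∈ t, s i = 0 then 1 else -1) * v s := by
    intro t
    induction t using Finset.induction_on with
    | empty => intro h; simp
    | insert i t hi ih =>
      intro h
      rw [Finset.noncommProd_insert_of_notMem _ _ _ _ hi, Finset.sum_insert hi, ← sign,
        mul_assoc, ← ih (fun a ha b hb hab => h (by simp [ha]) (by simp [hb]) hab)]
      rfl
  exact key _ _

theorem stringX_apply {ι : Type*} [DecidableEq ι] [Fintype ι] (x : ι → ZMod 2) (v : Qubits ι)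
    (s : ι → ZMod 2) : stringX x v s = v (s + x) := by
  classical
  have hx : x = ∑ i with x i ≠ 0, Pi.single i 1 := by
    ext j
    rw [Finset.sum_apply, Finset.sum_filter]
    have : ∀ a : ZMod 2, a = if a ≠ 0 then 1 else 0 := by decide
    rw [Finset.sum_eq_single j]
    · simpa using this (x j)
    · intro i _ hij
      simp [Pi.single_eq_of_ne hij.symm]
    · simp
  have key : ∀ (t : Finset ι) (h) (s), (t.noncommProd pauliX h) v s =
      v (s + ∑ i ∈ t, Pi.single i 1) := by
    intro t
    induction t using Finset.induction_on with
    | empty => intro h s; simp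
    | insert i t hi ih =>
      intro h s
      rw [Finset.noncommProd_insert_of_notMem _ _ _ _ hi, Finset.sum_insert hi, ← add_assoc,
        ← ih (fun a ha b hb hab => h (by simp [ha]) (by simp [hb]) hab)]
      rfl
  exact (key _ _ s).trans (by rw [← hx])

/-- Each factor is the diagonal projector onto even overlap with its loop, so the product is the
indicator of the joint condition. -/
theorem projectors_apply {ι : Type*} [DecidableEq ι] [Fintype ι] {m : ℕ}
    (z : Fin m → ι → ZMod 2) (v : Qubits ι) (s : ι → ZMod 2) :
    (List.ofFn fun i => (1 / 2 : ℂ) • (1 + stringZ (z i))).prod v s =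
      if ∀ i, z i ⬝ᵥ s = 0 then v s else 0 := by
  induction m with
  | zero => simp
  | succ m ih =>
    rw [List.ofFn_succ, List.prod_cons, Module.End.mul_apply]
    have h : ∀ w : Qubits ι, ((1 / 2 : ℂ) • (1 + stringZ (z 0))) w s =
        if z 0 ⬝ᵥ s = 0 then w s else 0 := by
      intro w
      change (1 / 2 : ℂ) * (w s + stringZ (z 0) w s) = _
      rw [stringZ_apply]
      split_ifs <;> ring
    rw [h, ih]
    simp only [Fin.forall_fin_succ, ite_and]

theorem strings_apply {ι : Type*} [DecidableEq ι] [Fintype ι] {m : ℕ}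
    (x : Fin m → ι → ZMod 2) (k : Fin m → Fin 2) (v : Qubits ι) (s : ι → ZMod 2) :
    (List.ofFn fun i => stringX (x i) ^ (k i : ℕ)).prod v s =
      v (s + ∑ i, ((k i : ℕ) : ZMod 2) • x i) := by
  induction m generalizing s with
  | zero => simp
  | succ m ih =>
    rw [List.ofFn_succ, List.prod_cons, Module.End.mul_apply]
    have h : ∀ (j : Fin 2) (w : Qubits ι), (stringX (x 0) ^ (j : ℕ)) w s =
        w (s + ((j : ℕ) : ZMod 2) • x 0) := by
      intro j w
      fin_cases j
      · simp
      · simpa using stringX_apply (x 0) w s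
    rw [h, ih, Fin.sum_univ_succ, add_assoc]

variable {D : Type*} [Fintype D] {M : SurfaceGraph D} {R : Set M.Face}

theorem cycles_eq_perp : M.cycles = perp M.dualBoundaries := by
  ext z
  rw [mem_perp]
  constructor
  · intro h w hw
    induction hw using Submodule.span_induction with
    | mem w hw => obtain ⟨s, rfl⟩ := hw; rw [dotProduct_comm]; exact h s
    | zero => exact zero_dotProduct _
    | add a b _ _ ha hb => rw [add_dotProduct, ha, hb, add_zero]
    | smul c a _ ha => rw [smul_dotProduct, ha, smul_zero]
  · intro h s
    rw [dotProduct_comm]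
    exact h _ (Submodule.subset_span ⟨s, rfl⟩)

/-- S is its own double complement, its complement is the cycle space, and the listed plaquettes and
loops span the cycles. -/
theorem mem_dualBoundaries_iff {m κ : ℕ} {p : Fin m → M.Face} (hp : M.IsIndepPlaquettes R p)
    {z : Fin κ → M.Chain} (hz : M.IsLoopBasis R z) {s : M.Chain} :
    s ∈ M.dualBoundaries ↔ (∀ i, M.plaquette (p i) ⬝ᵥ s = 0) ∧ ∀ i, z i ⬝ᵥ s = 0 := by
  rw [← perp_perp M.dualBoundaries, ← cycles_eq_perp, ← hz.2, ← hp.2.2, ← Submodule.span_union,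
    mem_perp]
  constructor
  · intro h
    exact ⟨fun i => h _ (Submodule.subset_span (Or.inl ⟨i, rfl⟩)),
      fun i => h _ (Submodule.subset_span (Or.inr ⟨i, rfl⟩))⟩
  · rintro ⟨h₁, h₂⟩ w hw
    induction hw using Submodule.span_induction with
    | mem w hw =>
      rcases hw with ⟨i, rfl⟩ | ⟨i, rfl⟩
      exacts [h₁ i, h₂ i]
    | zero => exact zero_dotProduct _
    | add a b _ _ ha hb => rw [add_dotProduct, ha, hb, add_zero]
    | smul c a _ ha => rw [smul_dotProduct, ha, smul_zero]

open scoped Classical in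
theorem groundState_apply {m κ : ℕ} {p : Fin m → M.Face} (hp : M.IsIndepPlaquettes R p)
    {z : Fin κ → M.Chain} (hz : M.IsLoopBasis R z) (N : ℂ) (s : M.Chain) :
    M.groundState p z N s =
      if s ∈ M.dualBoundaries then N * ∏ _i : M.Edge, ((Real.sqrt 2 : ℝ) : ℂ)⁻¹ else 0 := by
  rw [groundState, Module.End.mul_apply, PiLp.smul_apply, smul_eq_mul,
    projectors_apply (fun i => M.plaquette (p i)), projectors_apply,
    if_congr (mem_dualBoundaries_iff hp hz) rfl rfl, ite_and, mul_ite, mul_ite, mul_zero]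
  rfl

theorem dualBoundaries_le_dualCycles {κ : ℕ} {x : Fin κ → M.Chain} (hx : M.IsDualLoopBasis R x) :
    M.dualBoundaries ≤ M.dualCycles R :=
  hx.2 ▸ le_sup_left

theorem eq_of_sum_sub_sum_mem {κ : ℕ} {x : Fin κ → M.Chain} (hx : M.IsDualLoopBasis R x)
    {k l : Fin κ → Fin 2} (h : ∑ i, ((k i : ℕ) : ZMod 2) • x i -
      ∑ i, ((l i : ℕ) : ZMod 2) • x i ∈ M.dualBoundaries) : k = l := by
  have h' := Fintype.linearIndependent_iff.1 hx.1
    (fun i => ((k i : ℕ) : ZMod 2) - ((l i : ℕ) : ZMod 2)) (by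
      rw [← Finset.sum_sub_distrib, ← Submodule.Quotient.mk_eq_zero] at h
      rw [← h, ← Submodule.mkQ_apply, map_sum]
      refine Finset.sum_congr rfl fun i _ => ?_
      rw [← sub_smul, map_smul]
      rfl)
  have inj : ∀ a b : Fin 2, ((a : ℕ) : ZMod 2) - ((b : ℕ) : ZMod 2) = 0 → a = b := by decide
  exact funext fun i => inj _ _ (h' i)

/-- The translates of ψ live on different cosets of S, by independence of the dual loops, so they
are orthonormal and the norm is that of `c`. -/
theorem norm_genericState {κ : ℕ} {x : Fin κ → M.Chain} (hx : M.IsDualLoopBasis R x)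
    {ψ : Qubits M.Edge} (hψ : ‖ψ‖ = 1) (hsupp : ∀ s ∉ M.dualBoundaries, ψ s = 0)
    {c : (Fin κ → Fin 2) → ℂ} (hc : ∑ k, ‖c k‖ ^ 2 = 1) : ‖M.genericState x ψ c‖ = 1 := by
  have horth : Orthonormal ℂ fun k : Fin κ → Fin 2 =>
      (List.ofFn fun i => stringX (x i) ^ (k i : ℕ)).prod ψ := by
    refine orthonormal_of_disjoint_support _ (fun k => ?_) fun k l s hk hl => ?_
    · rw [← hψ, EuclideanSpace.norm_eq, EuclideanSpace.norm_eq]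
      simp only [strings_apply]
      congr 1
      exact Equiv.sum_comp (Equiv.addRight (∑ i, ((k i : ℕ) : ZMod 2) • x i))
        fun s => ‖ψ s‖ ^ 2
    · rw [strings_apply] at hk hl
      have hk' := by_contra fun h => hk (hsupp _ h)
      have hl' := by_contra fun h => hl (hsupp _ h)
      refine eq_of_sum_sub_sum_mem hx ?_
      have := M.dualBoundaries.sub_mem hk' hl'
      rwa [add_sub_add_left_eq_sub] at this
  have h := horth.inner_sum c c Finset.univ
  rw [← sq_eq_sq₀ (norm_nonneg _) zero_le_one, one_pow, ← hc]
  have h' := inner_self_eq_norm_sq_to_K (𝕜 := ℂ) (M.genericState x ψ c)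
  rw [genericState, h] at h'
  have h'' : ((∑ k, ‖c k‖ ^ 2 : ℝ) : ℂ) = ((‖M.genericState x ψ c‖ ^ 2 : ℝ) : ℂ) := by
    push_cast
    refine Eq.trans (Finset.sum_congr rfl fun k _ => ?_) h'
    exact (Complex.conj_mul' (c k)).symm
  exact_mod_cast h''.symm

theorem genericState_apply {κ : ℕ} (x : Fin κ → M.Chain) (ψ : Qubits M.Edge)
    (c : (Fin κ → Fin 2) → ℂ) (s : M.Chain) :
    M.genericState x ψ c s = ∑ k, c k * ψ (s + ∑ i, ((k i : ℕ) : ZMod 2) • x i) := by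
  rw [genericState, WithLp.ofLp_sum, Finset.sum_apply]
  refine Finset.sum_congr rfl fun k _ => ?_
  rw [PiLp.smul_apply, strings_apply, smul_eq_mul]

end GroundStates

end SurfaceGraph

theorem mainTheorem7 {D : Type*} [Fintype D] (M : SurfaceGraph D) (R : Set M.Face)
    (A : Set M.Edge) (hA : M.IsDisc R A)
    {m κ : ℕ} (p : Fin m → M.Face) (hp : M.IsIndepPlaquettes R p)
    (z : Fin κ → M.Chain) (hz : M.IsLoopBasis R z)
    (x : Fin κ → M.Chain) (hx : M.IsDualLoopBasis R x)
    (N : ℂ) (hN : ‖M.groundState p z N‖ = 1)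
    (n μmax : ℕ) (hn : n = M.crossing R A) (hμ : μmax = 2 ^ (n - 1)) :
    1 ≤ n ∧
    ∃ e : Fin μmax → Qubits A, Orthonormal ℂ e ∧
      (∃ f : Fin μmax → Qubits ↥(Aᶜ), Orthonormal ℂ f ∧
        M.groundState p z N =
          ((μmax : ℝ) ^ (-(1 / 2) : ℝ)) • ∑ μ, Qubits.tensor (e μ) (f μ)) ∧
      ∀ c : (Fin κ → Fin 2) → ℂ, ∑ k, ‖c k‖ ^ 2 = 1 →
        ∃ f : Fin μmax → Qubits ↥(Aᶜ), Orthonormal ℂ f ∧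
          M.genericState x (M.groundState p z N) c =
            ((μmax : ℝ) ^ (-(1 / 2) : ℝ)) • ∑ μ, Qubits.tensor (e μ) (f μ) := by
  classical
  subst hn hμ
  refine ⟨hA.one_le_crossing, ?_⟩
  have hSX := SurfaceGraph.dualBoundaries_le_dualCycles hx
  obtain ⟨e, he, hschmidt⟩ := Qubits.exists_schmidt A M.dualBoundaries (M.dualCycles R)
    (fun y hy => hA.perp_le_map_restrict (hA.restrict_mem_perp hy))
    (fun a ha => (hA.finrank_facts hSX).1.ge ha) _ (hA.card_map_restrict hSX)
  have hsupp : ∀ s ∉ M.dualBoundaries, M.groundState p z N s = 0 := fun s hs => by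
    rw [SurfaceGraph.groundState_apply hp hz, if_neg hs]
  have hinv : ∀ s, ∀ t ∈ M.dualBoundaries,
      M.groundState p z N (s + t) = M.groundState p z N s := fun s t ht => by
    rw [SurfaceGraph.groundState_apply hp hz, SurfaceGraph.groundState_apply hp hz,
      if_congr (M.dualBoundaries.add_mem_iff_left ht) rfl rfl]
  refine ⟨e, he, hschmidt _ hN (fun s hs => hsupp s fun h => hs (hSX h)) hinv, fun c hc => ?_⟩
  refine hschmidt _ (SurfaceGraph.norm_genericState hx hN hsupp hc) (fun s hs => ?_)
    fun s t ht => ?_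
  · rw [SurfaceGraph.genericState_apply]
    refine Finset.sum_eq_zero fun k _ => ?_
    rw [hsupp, mul_zero]
    intro h
    -- The `k`-th term lives on a translate of S by a dual cycle, which stays inside X.
    have hxk : ∑ i, ((k i : ℕ) : ZMod 2) • x i ∈ M.dualCycles R :=
      Submodule.sum_mem _ fun i _ => Submodule.smul_mem _ _ (by
        rw [← hx.2]
        exact Submodule.mem_sup_right (Submodule.subset_span ⟨i, rfl⟩))
    exact hs (((M.dualCycles R).add_mem_iff_left hxk).1 (hSX h))
  · rw [SurfaceGraph.genericState_apply, SurfaceGraph.genericState_apply]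
    refine Finset.sum_congr rfl fun k _ => ?_
    rw [add_right_comm, hinv _ _ ht]
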